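/- **Setting.** A single batch of $n$ packets contends for a slotted channel. A backoff algorithm runs through contention windows $i=0,1,2,\dots$ with $w_0,w_1,w_2,\dots\ge 1$ slots. In window $i$, every packet that has not yet succeeded transmits in one slot of the window, chosen uniformly at random from its $w_i$ slots, independently of all other choices. A packet that is alone in its slot succeeds and leaves; all other packets continue with window $i+1$. A collision is a slot in which at least two packets transmit, and the number of collisions of an execution is the total number of such slots over all windows. Write $\lg=\log_2$. Log-Backoff is either of the following two window schedules: 1. (doubling version) $W$ runs through $1,2,4,8,\dots$, and a window with $W$ slots is executed $\lg W$ times in succession (once if $W=1$), so the numbers of slots are $1,2,4,4,8,8,8,\dots$; 2. (monotone version) $W_0=1$ and $W_{i+1}=(1+r_i)W_i$ with $r_i=1/\lg W_i$ (and $r_0=1$, since $\lg W_0=0$), and window $i$ has $\lceil W_i\rceil$ slots. **Claim.** For a single batch of $n$ packets, Log-Backoff (in either version) experiences $\Omega\!\left(\frac{n\lg n}{\lg\lg n}\right)$ collisions with high probability. That is, for each version there is a constant $C>0$ such that for every constant $c>1$ and all sufficiently large $n$, $$\Pr\left[\#\text{collisions}\ \ge\ C\,\frac{n\lg n}{\lg\lg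 n}\right]\ \ge\ 1-\frac1{n^{c}} .$$ -/

import Mathlib

open MeasureTheory ProbabilityTheory Filter
open scoped ENNReal

namespace LogBackoff

/-! ### Executing a backoff schedule on a single batch

A schedule `w : ℕ → ℕ+` gives the number of slots of the successive contention windows. -/

/-- All slot choices for `n` packets: in window `i`, packet `p` picks the slot `x i p`. The choice
of a packet that has already succeeded is never used. -/
abbrev Choices (w : ℕ → ℕ+) (n : ℕ) : Type :=
  (i : ℕ) → Fin n → Fin (w i : ℕ)

/-- The law of the choices: independent over windows and packets, and uniform over the slots of
the window. -/
noncomputable def choiceLaw (w : ℕ → ℕ+) (n : ℕ) : Measure (Choices w n) :=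
  Measure.infinitePi fun i : ℕ =>
    Measure.pi fun _ : Fin n => uniformOn (Set.univ : Set (Fin (w i : ℕ)))

/-- The packets that have not succeeded before window `i`. An unfinished packet fails in
window `i` iff another unfinished packet picks the same slot. -/
def active {w : ℕ → ℕ+} {n : ℕ} (x : Choices w n) : ℕ → Finset (Fin n)
  | 0 => Finset.univ
  | i + 1 => (active x i).filter fun p => ∃ q ∈ active x i, q ≠ p ∧ x i q = x i p

/-- The number of collisions in window `i`: slots in which at least two unfinished packets
transmit. -/
def windowCollisions {w : ℕ → ℕ+} {n : ℕ} (x : Choices w n) (i : ℕ) : ℕ :=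
  (Finset.univ.filter fun s : Fin (w i : ℕ) =>
    2 ≤ ((active x i).filter fun p => x i p = s).card).card

/-- The number of collisions in the whole execution. Windows after the last success contribute
nothing, as no packet is active in them. -/
noncomputable def collisions {w : ℕ → ℕ+} {n : ℕ} (x : Choices w n) : ℝ≥0∞ :=
  ∑' i, (windowCollisions x i : ℝ≥0∞)

/-! ### The two specifications of Log-Backoff -/

/-- State of the doubling version: the current window size `W` (a power of two) and the number of
executions of a window of this size already completed. Windows of size `W` are executed `lg W`
times (once if `W = 1`), then `W` doubles. -/
def doublingState : ℕ → ℕ+ × ℕ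
  | 0 => (1, 0)
  | i + 1 =>
    if (doublingState i).2 + 1 < Nat.log 2 (doublingState i).1 then
      ((doublingState i).1, (doublingState i).2 + 1)
    else (2 * (doublingState i).1, 0)

/-- Window sizes `1, 2, 4, 4, 8, 8, 8, 16, …` of the doubling version of Log-Backoff. -/
def doublingSchedule (i : ℕ) : ℕ+ := (doublingState i).1

/-- The window size of the monotone version: start with `W = 1` and repeat
`W ← (1 + r) W` with `r = 1 / lg W`. The maximum only matters at `W = 1`, where `lg W = 0`
and `r = 1` is used; all later values of `W` are at least `2`. -/
noncomputable def monotoneSize : ℕ → ℝ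
  | 0 => 1
  | i + 1 => (1 + 1 / max 1 (Real.logb 2 (monotoneSize i))) * monotoneSize i

theorem monotoneSize_pos (i : ℕ) : 0 < monotoneSize i := by
  induction i with
  | zero => simp [monotoneSize]
  | succ i ih => rw [monotoneSize]; positivity

/-- The monotone version of Log-Backoff; a window of real size `W` has `⌈W⌉` slots. -/
noncomputable def monotoneSchedule (i : ℕ) : ℕ+ :=
  ⟨⌈monotoneSize i⌉₊, Nat.ceil_pos.2 (monotoneSize_pos i)⟩

end LogBackoff

/-! Cut the execution at the first window with more than `M ≈ n / (32 lg lg n)` slots. Both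
schedules grow so slowly that the `b` windows before the cut satisfy `b ≤ lg² M + 1` and contain at
least `M (lg M - 4)` slots in total, which is of order `n lg n / lg lg n`
(`HasLogGrowth.exists_first_gt`).

While `n / 2` packets remain, each of these windows has load at least `16 lg lg n`. A union bound
over sets of light slots then shows that at most a fraction `1 / (2b)` of its slots is light, up to
exponentially small probability (`windowLaw_real_lightSlots_gt_le`). Successful packets occupy
distinct light slots, so each window loses at most `n / (2b)` packets. Hence half of the batch
survives all `b` windows, and at least half of all their slots are collisions
(`half_sum_le_collisions`). The total failure probability `b exp(-n / (16b))` beats every power of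
`n`, so `C` need not depend on `c`. -/

namespace LogBackoff

/-! ### Light slots in a single window. -/

/-- The slots in which at most one packet of `A` transmits. -/
def lightSlots {n W : ℕ} (A : Finset (Fin n)) (f : Fin n → Fin W) : Finset (Fin W) :=
  Finset.univ.filter fun s => (A.filter fun p => f p = s).card ≤ 1

/-- The law of the slot choices in one window. -/
noncomputable abbrev windowLaw (n W : ℕ) : Measure (Fin n → Fin W) :=
  Measure.pi fun _ : Fin n => uniformOn (Set.univ : Set (Fin W))

theorem isProbabilityMeasure_uniformOn_fin {W : ℕ} (hW : 0 < W) :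
    IsProbabilityMeasure (uniformOn (Set.univ : Set (Fin W))) := by
  have : Nonempty (Fin W) := ⟨⟨0, hW⟩⟩
  exact isProbabilityMeasure_uniformOn Set.finite_univ Set.univ_nonempty

theorem windowLaw_real_singleton {n W : ℕ} (f : Fin n → Fin W) :
    (windowLaw n W).real {f} = ((W : ℝ)⁻¹) ^ n := by
  have h (s : Fin W) : (uniformOn (Set.univ : Set (Fin W))) {s} = (W : ℝ≥0∞)⁻¹ := by
    rw [uniformOn_univ]
    simp
  rw [measureReal_def, Measure.pi_singleton]
  simp [h]

theorem card_filter_mem_le_of_subset_lightSlots {n W : ℕ} {A : Finset (Fin n)}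
    {f : Fin n → Fin W} {T : Finset (Fin W)} (hT : T ⊆ lightSlots A f) :
    (A.filter fun p => f p ∈ T).card ≤ T.card := by
  have := Finset.card_le_mul_card_image_of_maps_to (s := A.filter fun p => f p ∈ T) (t := T)
    (f := f) (fun p hp => (Finset.mem_filter.1 hp).2) 1 (fun s hs => ?_)
  · simpa using this
  · have h1 := (Finset.mem_filter.1 (hT hs)).2
    refine (Finset.card_le_card ?_).trans h1
    intro p hp
    simp only [Finset.mem_filter] at hp ⊢
    exact ⟨hp.1.1, hp.2⟩

/-- Up to the factor `W ^ n`, this is the expectation of `2 ^ (-N)`, where `N` counts the packets of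
`A` landing in `T`; it factors over packets. -/
theorem sum_prod_half {n W : ℕ} (hW : 0 < W) (A : Finset (Fin n)) (T : Finset (Fin W)) :
    ∑ f : Fin n → Fin W, ∏ p, (if p ∈ A ∧ f p ∈ T then (1 / 2 : ℝ) else 1)
      = (W : ℝ) ^ n * (1 - T.card / (2 * W)) ^ A.card := by
  have hW' : (W : ℝ) ≠ 0 := by positivity
  have key : ∀ p : Fin n, ∑ s : Fin W, (if p ∈ A ∧ s ∈ T then (1 / 2 : ℝ) else 1)
      = W * (if p ∈ A then (1 - (T.card : ℝ) / (2 * W)) else 1) := by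
    intro p
    by_cases hp : p ∈ A
    · have : ∀ s : Fin W, (if p ∈ A ∧ s ∈ T then (1 / 2 : ℝ) else 1)
          = 1 - (if s ∈ T then 1 / 2 else 0) := by
        intro s
        by_cases hs : s ∈ T <;> simp [hp, hs]
        norm_num
      simp only [this, Finset.sum_sub_distrib, ← Finset.sum_filter]
      simp [hp]
      field_simp
    · simp [hp]
  have h := Finset.prod_univ_sum (fun _ : Fin n => (Finset.univ : Finset (Fin W)))
    (fun p s => if p ∈ A ∧ s ∈ T then (1 / 2 : ℝ) else 1)
  rw [Fintype.piFinset_univ] at h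
  rw [← h]
  simp only [key, Finset.prod_mul_distrib, Finset.prod_const, Finset.card_univ, Fintype.card_fin]
  rw [Finset.prod_ite_mem, Finset.univ_inter, Finset.prod_const]

/-- Markov's inequality for `2 ^ (|T| - N)`, which is at least `1` when all of `T` is light. This
avoids the dependence between slots. -/
theorem windowLaw_real_subset_lightSlots_le {n W : ℕ} (hW : 0 < W) (A : Finset (Fin n))
    (T : Finset (Fin W)) :
    (windowLaw n W).real {f | T ⊆ lightSlots A f}
      ≤ (2 * Real.exp (-(A.card / (2 * W)))) ^ T.card := by
  classical
  have := isProbabilityMeasure_uniformOn_fin hW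
  have hset : {f : Fin n → Fin W | T ⊆ lightSlots A f}
      = ((Finset.univ.filter fun f => T ⊆ lightSlots A f : Finset (Fin n → Fin W)) : Set _) := by
    ext; simp
  have hTW : (T.card : ℝ) ≤ W := by
    exact_mod_cast (Finset.card_le_univ T).trans_eq (Fintype.card_fin W)
  have hWp : (0 : ℝ) < W := by exact_mod_cast hW
  have hfrac : (T.card : ℝ) / (2 * W) ≤ 1 := by
    rw [div_le_one (by positivity)]; linarith
  rw [hset, ← sum_measureReal_singleton]
  simp only [windowLaw_real_singleton]
  calc ∑ f ∈ Finset.univ.filter (fun f : Fin n → Fin W => T ⊆ lightSlots A f), ((W : ℝ)⁻¹) ^ n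
      ≤ ∑ f ∈ Finset.univ.filter (fun f : Fin n → Fin W => T ⊆ lightSlots A f),
          ((W : ℝ)⁻¹) ^ n * (2 ^ T.card *
            ∏ p, (if p ∈ A ∧ f p ∈ T then (1 / 2 : ℝ) else 1)) := by
        refine Finset.sum_le_sum fun f hf => ?_
        have hc := card_filter_mem_le_of_subset_lightSlots (Finset.mem_filter.1 hf).2
        refine le_mul_of_one_le_right (by positivity) ?_
        have hprod : ∏ p, (if p ∈ A ∧ f p ∈ T then (1 / 2 : ℝ) else 1)
            = (1 / 2) ^ (A.filter fun p => f p ∈ T).card := by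
          rw [← Finset.prod_filter, Finset.prod_const]
          congr 2
          ext; simp
        rw [hprod]
        calc (1 : ℝ) = 2 ^ T.card * (1 / 2) ^ T.card := by rw [← mul_pow]; norm_num
          _ ≤ _ := by
            gcongr 2 ^ T.card * ?_
            exact pow_le_pow_of_le_one (by norm_num) (by norm_num) hc
    _ ≤ ∑ f : Fin n → Fin W, ((W : ℝ)⁻¹) ^ n * (2 ^ T.card *
            ∏ p, (if p ∈ A ∧ f p ∈ T then (1 / 2 : ℝ) else 1)) := by
        refine Finset.sum_le_sum_of_subset_of_nonneg (Finset.filter_subset _ _) fun f _ _ => ?_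
        have : 0 ≤ ∏ p, (if p ∈ A ∧ f p ∈ T then (1 / 2 : ℝ) else 1) :=
          Finset.prod_nonneg fun p _ => by split_ifs <;> norm_num
        positivity
    _ = 2 ^ T.card * (1 - (T.card : ℝ) / (2 * W)) ^ A.card := by
        rw [← Finset.mul_sum, ← Finset.mul_sum, sum_prod_half hW]
        rw [mul_left_comm, ← mul_assoc ((W : ℝ)⁻¹ ^ n), ← mul_pow, inv_mul_cancel₀ hWp.ne',
          one_pow, one_mul]
    _ ≤ 2 ^ T.card * (Real.exp (-(T.card / (2 * W)))) ^ A.card := by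
        gcongr
        exact Real.one_sub_le_exp_neg _
    _ = _ := by
        rw [mul_pow, ← Real.exp_nat_mul, ← Real.exp_nat_mul]
        congr 2
        ring

theorem windowLaw_real_le_card_lightSlots_le {n W : ℕ} (hW : 0 < W) (A : Finset (Fin n)) (t : ℕ) :
    (windowLaw n W).real {f | t ≤ (lightSlots A f).card}
      ≤ W.choose t * (2 * Real.exp (-(A.card / (2 * W)))) ^ t := by
  have := isProbabilityMeasure_uniformOn_fin hW
  have hsub : {f : Fin n → Fin W | t ≤ (lightSlots A f).card}
      ⊆ ⋃ T ∈ Finset.powersetCard t (Finset.univ : Finset (Fin W)),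
          {f | T ⊆ lightSlots A f} := by
    intro f hf
    obtain ⟨T, hT, hc⟩ := Finset.exists_subset_card_eq (show t ≤ (lightSlots A f).card from hf)
    simp only [Set.mem_iUnion]
    exact ⟨T, Finset.mem_powersetCard.2 ⟨Finset.subset_univ _, hc⟩, hT⟩
  refine (measureReal_mono hsub (measure_ne_top _ _)).trans
    ((measureReal_biUnion_finset_le _ _).trans ?_)
  calc _ ≤ ∑ T ∈ Finset.powersetCard t (Finset.univ : Finset (Fin W)),
        (2 * Real.exp (-(A.card / (2 * W)))) ^ t := by
        refine Finset.sum_le_sum fun T hT => ?_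
        rw [← (Finset.mem_powersetCard.1 hT).2]
        exact windowLaw_real_subset_lightSlots_le hW A T
    _ = _ := by simp

theorem choose_le_exp_mul_div_pow (W t : ℕ) :
    (W.choose t : ℝ) ≤ (Real.exp 1 * W / t) ^ t := by
  rcases Nat.eq_zero_or_pos t with rfl | ht
  · simp
  have h1 : (W.choose t : ℝ) ≤ W ^ t / t.factorial := Nat.choose_le_pow_div t W
  have h2 := Real.pow_div_factorial_le_exp (t : ℝ) (by positivity) t
  have ht' : (0 : ℝ) < t := by exact_mod_cast ht
  have h3 : (Real.exp 1) ^ t = Real.exp t := by rw [← Real.exp_nat_mul]; simp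
  refine h1.trans ?_
  rw [div_pow, mul_pow, h3, div_le_div_iff₀ (by positivity) (by positivity)]
  rw [div_le_iff₀ (by positivity)] at h2
  have : (0 : ℝ) ≤ W ^ t := by positivity
  nlinarith

/-- If at least `m` packets are active in a window whose load is large compared with `log B`,
then only a fraction `1 / B` of the slots is light, up to an exponentially small probability. -/
theorem windowLaw_real_lightSlots_gt_le {n W : ℕ} (hW : 0 < W) (A : Finset (Fin n)) {B m : ℝ}
    (hB : 0 < B) (hm : m ≤ A.card)
    (hload : 2 * Real.exp 1 * B ≤ Real.exp (m / (4 * W))) :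
    (windowLaw n W).real {f | (W : ℝ) / B < (lightSlots A f).card}
      ≤ Real.exp (-(m / (4 * B))) := by
  have := isProbabilityMeasure_uniformOn_fin hW
  have hWp : (0 : ℝ) < W := by exact_mod_cast hW
  rcases le_or_gt m 0 with hm0 | hm0
  · refine measureReal_le_one.trans (Real.one_le_exp ?_)
    rw [neg_nonneg]
    exact div_nonpos_of_nonpos_of_nonneg hm0 (by positivity)
  set t : ℕ := ⌊(W : ℝ) / B⌋₊ + 1 with ht
  have htlt : (W : ℝ) / B < t := by rw [ht]; push_cast; exact Nat.lt_floor_add_one _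
  have ht0 : (0 : ℝ) < t := lt_of_le_of_lt (by positivity) htlt
  have hsub : {f : Fin n → Fin W | (W : ℝ) / B < (lightSlots A f).card}
      ⊆ {f | t ≤ (lightSlots A f).card} := by
    intro f hf
    exact Nat.succ_le_of_lt ((Nat.floor_lt (by positivity)).2 hf)
  refine (measureReal_mono hsub).trans ((windowLaw_real_le_card_lightSlots_le hW A t).trans ?_)
  -- One of the two equal factors cancels the binomial coefficient through `hload`; the other
  -- remains as the tail bound.
  have hE : Real.exp (-((A.card : ℝ) / (2 * W))) ≤
      Real.exp (-(m / (4 * W))) * Real.exp (-(m / (4 * W))) := by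
    rw [← Real.exp_add, Real.exp_le_exp]
    have : m / (2 * W) ≤ A.card / (2 * W) := by gcongr
    have h2 : m / (2 * W) = m / (4 * W) + m / (4 * W) := by ring
    linarith
  have hWt : (W : ℝ) / t ≤ B := by
    rw [div_le_iff₀ ht0]; rw [div_lt_iff₀ hB] at htlt; linarith
  calc (W.choose t : ℝ) * (2 * Real.exp (-((A.card : ℝ) / (2 * W)))) ^ t
      ≤ (Real.exp 1 * W / t) ^ t *
        (2 * (Real.exp (-(m / (4 * W))) * Real.exp (-(m / (4 * W))))) ^ t := by
        gcongr
        exact choose_le_exp_mul_div_pow W t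
    _ = ((2 * Real.exp 1 * (W / t)) * Real.exp (-(m / (4 * W)))
          * Real.exp (-(m / (4 * W)))) ^ t := by rw [← mul_pow]; ring
    _ ≤ (Real.exp (m / (4 * W)) * Real.exp (-(m / (4 * W))) * Real.exp (-(m / (4 * W)))) ^ t := by
        gcongr
        exact le_trans (by gcongr) hload
    _ = Real.exp (-(t * (m / (4 * W)))) := by
        rw [← Real.exp_add, add_neg_cancel, Real.exp_zero, one_mul, ← Real.exp_nat_mul]
        ring_nf
    _ ≤ _ := by
        rw [Real.exp_le_exp, neg_le_neg_iff]
        calc m / (4 * B) = (W / B) * (m / (4 * W)) := by field_simp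
          _ ≤ _ := by gcongr

/-! ### Independence of a window from its past. -/

theorem active_congr {w : ℕ → ℕ+} {n : ℕ} {x y : Choices w n} {i : ℕ}
    (h : ∀ j < i, x j = y j) : active x i = active y i := by
  induction i with
  | zero => rfl
  | succ i ih =>
    rw [active, active, ih fun j hj => h j (hj.trans i.lt_succ_self), h i i.lt_succ_self]

instance isProbabilityMeasure_choiceLaw (w : ℕ → ℕ+) (n : ℕ) :
    IsProbabilityMeasure (choiceLaw w n) := by
  have := fun i => isProbabilityMeasure_uniformOn_fin (w i).pos
  unfold choiceLaw
  infer_instance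

theorem exists_active_eq_preimage {w : ℕ → ℕ+} {n : ℕ} (i : ℕ) (A : Finset (Fin n)) :
    ∃ S : Set ((j : Finset.range i) → Fin n → Fin (w j)),
      {x : Choices w n | active x i = A}
        = (fun (x : Choices w n) (j : Finset.range i) => x j) ⁻¹' S := by
  let extend (y : (j : Finset.range i) → Fin n → Fin (w j)) : Choices w n := fun j =>
    if hj : j ∈ Finset.range i then y ⟨j, hj⟩ else fun _ => ⟨0, (w j).pos⟩
  refine ⟨{y | active (extend y) i = A}, ?_⟩
  ext x
  simp only [Set.mem_ofPred_eq, Set.mem_preimage]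
  rw [active_congr (y := extend fun j => x j)]
  intro j hj
  simp [extend, hj]

/-- The choices in window `i` are independent of the packets active in it. -/
theorem choiceLaw_real_active_inter {w : ℕ → ℕ+} {n : ℕ} (i : ℕ) (A : Finset (Fin n))
    (S : Set (Fin n → Fin (w i))) :
    (choiceLaw w n).real ({x | active x i = A} ∩ {x | x i ∈ S})
      = (choiceLaw w n).real {x | active x i = A} * (windowLaw n (w i)).real S := by
  have := fun i => isProbabilityMeasure_uniformOn_fin (w i).pos
  have hind : iIndepFun (fun (j : ℕ) (x : Choices w n) => x j) (choiceLaw w n) :=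
    iIndepFun_infinitePi (P := fun i : ℕ => windowLaw n (w i))
      (X := fun j (y : Fin n → Fin (w j)) => y) (fun j => measurable_id)
  have h2 := hind.indepFun_finset (Finset.range i) {i} (by simp)
    (fun j => measurable_pi_apply j)
  obtain ⟨S', hA⟩ := exists_active_eq_preimage (w := w) i A
  have hS : {x : Choices w n | x i ∈ S}
      = (fun (x : Choices w n) (j : ({i} : Finset ℕ)) => x j) ⁻¹'
        {y | y ⟨i, Finset.mem_singleton_self i⟩ ∈ S} := rfl
  have hm : (choiceLaw w n) {x | x i ∈ S} = windowLaw n (w i) S := by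
    rw [← Measure.infinitePi_map_eval (fun i : ℕ => windowLaw n (w i)) i,
      Measure.map_apply (measurable_pi_apply i) (Set.toFinite S).measurableSet]
    rfl
  rw [measureReal_def, measureReal_def, measureReal_def, ← hm, ← ENNReal.toReal_mul]
  congr 1
  rw [hA, hS]
  exact h2.measure_inter_preimage_eq_mul _ _ (Set.toFinite _).measurableSet
    (Set.toFinite _).measurableSet

/-- Conditioning on the finitely many values of the active set transfers a bound uniform in fixed
`A` to the random active set. -/
theorem choiceLaw_real_active_le {w : ℕ → ℕ+} {n : ℕ} (i : ℕ)
    (E : Finset (Fin n) → Set (Fin n → Fin (w i))) {ε : ℝ}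
    (hE : ∀ A, (windowLaw n (w i)).real (E A) ≤ ε) :
    (choiceLaw w n).real {x | x i ∈ E (active x i)} ≤ ε := by
  have hsub : {x : Choices w n | x i ∈ E (active x i)}
      ⊆ ⋃ A ∈ (Finset.univ : Finset (Finset (Fin n))),
        {x | active x i = A} ∩ {x | x i ∈ E A} := by
    intro x hx
    simp only [Set.mem_iUnion]
    exact ⟨active x i, Finset.mem_univ _, rfl, hx⟩
  have hmeas (A : Finset (Fin n)) : MeasurableSet {x : Choices w n | active x i = A} := by
    obtain ⟨S', hA⟩ := exists_active_eq_preimage (w := w) i A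
    rw [hA]
    exact measurableSet_preimage (by fun_prop) (Set.toFinite _).measurableSet
  have hsum : ∑ A : Finset (Fin n), (choiceLaw w n).real {x | active x i = A} = 1 := by
    have := measureReal_biUnion_finset (μ := choiceLaw w n)
      (s := (Finset.univ : Finset (Finset (Fin n)))) (f := fun A => {x | active x i = A})
      (fun A _ B _ hAB => Set.disjoint_left.2 fun x hx hy => hAB (hx.symm.trans hy))
      (fun A _ => hmeas A)
    rw [← this]
    convert probReal_univ (μ := choiceLaw w n)
    ext x; simp
  refine (measureReal_mono hsub (measure_ne_top _ _)).trans
    ((measureReal_biUnion_finset_le _ _).trans ?_)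
  calc _ ≤ ∑ A : Finset (Fin n), (choiceLaw w n).real {x | active x i = A} * ε := by
        refine Finset.sum_le_sum fun A _ => ?_
        rw [choiceLaw_real_active_inter]
        gcongr
        exact hE A
    _ = ε := by rw [← Finset.sum_mul, hsum, one_mul]

/-! ### Survival of packets and number of collisions. -/

theorem card_lightSlots_add_windowCollisions {w : ℕ → ℕ+} {n : ℕ} (x : Choices w n) (i : ℕ) :
    (lightSlots (active x i) (x i)).card + windowCollisions x i = w i := by
  have h := Finset.card_filter_add_card_filter_not (s := (Finset.univ : Finset (Fin (w i : ℕ))))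
    (fun s => ((active x i).filter fun p => x i p = s).card ≤ 1)
  simp only [Finset.card_univ, Fintype.card_fin, not_le] at h
  exact h

/-- The map `x i` injects the packets that succeed into the light slots. -/
theorem card_active_le {w : ℕ → ℕ+} {n : ℕ} (x : Choices w n) (i : ℕ) :
    (active x i).card ≤ (active x (i + 1)).card + (lightSlots (active x i) (x i)).card := by
  rw [active, ← Finset.card_filter_add_card_filter_not (s := active x i)
    (fun p => ∃ q ∈ active x i, q ≠ p ∧ x i q = x i p)]
  gcongr
  have hcl : ∀ p ∈ (active x i).filter (fun p => ¬ ∃ q ∈ active x i, q ≠ p ∧ x i q = x i p),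
      ∀ q ∈ active x i, x i q = x i p → q = p := by
    intro p hp q hq hqp
    by_contra hne
    exact (Finset.mem_filter.1 hp).2 ⟨q, hq, hne, hqp⟩
  refine Finset.card_le_card_of_injOn (x i) (fun p hp => ?_) (fun p hp q hq hpq => ?_)
  · simp only [lightSlots, Finset.coe_filter, Finset.mem_univ, true_and, Set.mem_ofPred_eq]
    refine Finset.card_le_one.2 fun a ha b hb => ?_
    simp only [Finset.mem_filter] at ha hb
    rw [hcl p hp a ha.1 ha.2, hcl p hp b hb.1 hb.2]
  · exact hcl q hq p (Finset.mem_filter.1 hp).1 hpq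

/-- As long as few slots are light whenever half of the packets are active, half of the packets
stay active. -/
theorem half_le_card_active {w : ℕ → ℕ+} {n b : ℕ} (x : Choices w n)
    (hw : ∀ i < b, (w i : ℕ) ≤ n)
    (hx : ∀ i < b, (n : ℝ) / 2 ≤ (active x i).card →
      ((lightSlots (active x i) (x i)).card : ℝ) ≤ (w i : ℕ) / (2 * b))
    {i : ℕ} (hi : i < b) : (n : ℝ) / 2 ≤ (active x i).card := by
  have hb : (0 : ℝ) < b := by exact_mod_cast i.zero_le.trans_lt hi
  have key : ∀ j ≤ i, (n : ℝ) - j * (n / (2 * b)) ≤ (active x j).card ∧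
      (n : ℝ) / 2 ≤ (active x j).card := by
    intro j hj
    have hhalf (j : ℕ) (hj : j ≤ i) : (n : ℝ) / 2 ≤ n - j * (n / (2 * b)) := by
      have : (j : ℝ) ≤ b := by exact_mod_cast hj.trans hi.le
      have h1 : (j : ℝ) * (n / (2 * b)) ≤ b * (n / (2 * b)) := by gcongr
      have h2 : (b : ℝ) * (n / (2 * b)) = n / 2 := by field_simp
      linarith
    induction j with
    | zero => simp [active]
    | succ j ih =>
      obtain ⟨h1, h2⟩ := ih (by omega)
      have h3 := hx j (by omega) h2
      have h4 : ((active x j).card : ℝ) ≤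
          (active x (j + 1)).card + (lightSlots (active x j) (x j)).card := by
        exact_mod_cast card_active_le x j
      have h5 : ((w j : ℕ) : ℝ) / (2 * b) ≤ n / (2 * b) := by
        gcongr
        exact hw j (by omega)
      have h6 : (n : ℝ) - (j + 1 : ℕ) * (n / (2 * b)) ≤ (active x (j + 1)).card := by
        push_cast
        linarith
      exact ⟨h6, (hhalf _ hj).trans h6⟩
  exact (key i le_rfl).2

theorem half_sum_le_collisions {w : ℕ → ℕ+} {n b : ℕ} (x : Choices w n)
    (hw : ∀ i < b, (w i : ℕ) ≤ n)
    (hx : ∀ i < b, (n : ℝ) / 2 ≤ (active x i).card →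
      ((lightSlots (active x i) (x i)).card : ℝ) ≤ (w i : ℕ) / (2 * b)) :
    ENNReal.ofReal ((∑ i ∈ Finset.range b, ((w i : ℕ) : ℝ)) / 2) ≤ collisions x := by
  have h1 : (∑ i ∈ Finset.range b, ((w i : ℕ) : ℝ)) / 2
      ≤ ((∑ i ∈ Finset.range b, windowCollisions x i : ℕ) : ℝ) := by
    push_cast
    rw [Finset.sum_div]
    refine Finset.sum_le_sum fun i hi => ?_
    have hi := Finset.mem_range.1 hi
    have h := hx i hi (half_le_card_active x hw hx hi)
    have h2 : ((lightSlots (active x i) (x i)).card : ℝ) + windowCollisions x i = (w i : ℕ) := by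
      exact_mod_cast card_lightSlots_add_windowCollisions x i
    have hb : (1 : ℝ) ≤ b := by exact_mod_cast i.zero_le.trans_lt hi
    have h3 : ((w i : ℕ) : ℝ) / (2 * b) ≤ (w i : ℕ) / 2 := by
      gcongr; linarith
    linarith
  refine (ENNReal.ofReal_le_ofReal h1).trans ?_
  rw [ENNReal.ofReal_natCast]
  push_cast
  exact ENNReal.sum_le_tsum _

/-- If the load of each of the first `b` windows is large compared with `log b`, then, up to
an exponentially small probability, at least half of their slots are collisions. -/
theorem le_choiceLaw_real_collisions {w : ℕ → ℕ+} {n b M : ℕ} (hb : 0 < b) (hMn : M ≤ n)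
    (hw : ∀ i < b, (w i : ℕ) ≤ M)
    (hload : 4 * Real.exp 1 * b ≤ Real.exp (n / (8 * M))) :
    1 - b * Real.exp (-(n / (16 * b))) ≤ (choiceLaw w n).real
      {x | ENNReal.ofReal ((∑ i ∈ Finset.range b, ((w i : ℕ) : ℝ)) / 2) ≤ collisions x} := by
  have hbR : (0 : ℝ) < b := by exact_mod_cast hb
  let E (i : ℕ) (A : Finset (Fin n)) : Set (Fin n → Fin (w i)) :=
    -- Including the size condition empties the event for small `A`, so the bound is uniform in `A`.
    {f | (n : ℝ) / 2 ≤ A.card ∧ ((w i : ℕ) : ℝ) / (2 * b) < (lightSlots A f).card}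
  let bad (i : ℕ) : Set (Choices w n) := {x | x i ∈ E i (active x i)}
  have hbad : ∀ i ∈ Finset.range b, (choiceLaw w n).real (bad i) ≤
      Real.exp (-(n / (16 * b))) := by
    intro i hi
    refine choiceLaw_real_active_le i (E i) fun A => ?_
    by_cases hA : (n : ℝ) / 2 ≤ A.card
    · have hwp : (0 : ℝ) < (w i : ℕ) := by exact_mod_cast (w i).pos
      have := windowLaw_real_lightSlots_gt_le (w i).pos A (B := 2 * b) (by positivity) hA (by
        calc 2 * Real.exp 1 * (2 * b) = 4 * Real.exp 1 * b := by ring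
          _ ≤ Real.exp (n / (8 * M)) := hload
          _ ≤ Real.exp (n / (8 * (w i : ℕ))) := by
            gcongr
            exact hw i (Finset.mem_range.1 hi)
          _ = _ := by congr 1; field_simp; ring)
      simp only [E, hA, true_and]
      refine this.trans_eq ?_
      congr 2
      field_simp
      ring
    · simp only [E, hA, false_and, Set.ofPred_false, measureReal_empty]
      positivity
  have hcover : (Set.univ : Set (Choices w n)) ⊆
      {x | ENNReal.ofReal ((∑ i ∈ Finset.range b, ((w i : ℕ) : ℝ)) / 2) ≤ collisions x} ∪
        ⋃ i ∈ Finset.range b, bad i := by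
    intro x _
    by_cases hx : x ∈ ⋃ i ∈ Finset.range b, bad i
    · exact Or.inr hx
    · refine Or.inl (half_sum_le_collisions x (fun i hi => (hw i hi).trans hMn) ?_)
      intro i hi hA
      by_contra hlt
      refine hx ?_
      simp only [Set.mem_iUnion]
      exact ⟨i, Finset.mem_range.2 hi, hA, not_le.1 hlt⟩
  have h1 := measureReal_mono (μ := choiceLaw w n) hcover
  rw [probReal_univ] at h1
  have h2 := h1.trans (measureReal_union_le _ _)
  have h3 : (choiceLaw w n).real (⋃ i ∈ Finset.range b, bad i) ≤
      b * Real.exp (-(n / (16 * b))) := by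
    refine (measureReal_biUnion_finset_le _ _).trans ((Finset.sum_le_sum hbad).trans_eq ?_)
    simp
  linarith

/-! ### Growth of the two schedules. -/

/-- The window sizes are the ceilings of `V`, which grows fast enough that size `v` is reached
within `(lg v) ^ 2` windows, and slowly enough that these have `v * (lg v - 4)` slots. -/
structure HasLogGrowth (w : ℕ → ℕ+) (V : ℕ → ℝ) : Prop where
  eq_ceil (i : ℕ) : (w i : ℕ) = ⌈V i⌉₊
  zero_eq : V 0 = 1
  one_le (i : ℕ) : 1 ≤ V i
  index_le (i : ℕ) : (i : ℝ) ≤ Real.logb 2 (V i) ^ 2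
  le_sum (i : ℕ) : V i * (Real.logb 2 (V i) - 4) ≤ ∑ t ∈ Finset.range i, ((w t : ℕ) : ℝ)

/-- For `j ≥ 1`, exactly `i = 1 + j (j - 1) / 2 + k`, and the preceding slots number `(j + k - 2) 2
^ j + 3`. -/
theorem doublingState_spec (i : ℕ) : ∃ j k : ℕ, doublingState i = (2 ^ j, k) ∧
    (j = 0 → i = 0 ∧ k = 0) ∧ (j ≠ 0 → k + 1 ≤ j) ∧ 2 * i + j ≤ j * j + 2 * k + 2 ∧
    (j + k) * 2 ^ j ≤ ∑ t ∈ Finset.range i, (doublingSchedule t : ℕ) + 2 * 2 ^ j := by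
  induction i with
  | zero => exact ⟨0, 0, by simp [doublingState]⟩
  | succ i ih =>
    obtain ⟨j, k, hs, h0, hk, hi, hsum⟩ := ih
    have hw : (doublingSchedule i : ℕ) = 2 ^ j := by simp [doublingSchedule, hs]
    have hlog : Nat.log 2 (((2 : ℕ+) ^ j : ℕ+) : ℕ) = j := by simp
    rw [Finset.sum_range_succ, hw]
    by_cases hlt : k + 1 < j
    · refine ⟨j, k + 1, ?_, by omega, by omega, by omega, ?_⟩
      · rw [doublingState, hs]
        simp only [hlog, hlt, if_true]
      · linarith
    · refine ⟨j + 1, 0, ?_, by omega, by omega, ?_, ?_⟩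
      · rw [doublingState, hs]
        simp only [hlog, hlt, if_false]
        rw [pow_succ, mul_comm]
      · rcases Nat.eq_zero_or_pos j with rfl | hj
        · have := h0 rfl
          omega
        · have := hk hj.ne'
          have hjk : j = k + 1 := by omega
          subst hjk
          nlinarith
      · rcases Nat.eq_zero_or_pos j with rfl | hj
        · simp
        · have := hk hj.ne'
          have hjk : j = k + 1 := by omega
          subst hjk
          rw [pow_succ 2 (k + 1)]
          nlinarith

theorem hasLogGrowth_doublingSchedule :
    HasLogGrowth doublingSchedule fun i => ((doublingSchedule i : ℕ) : ℝ) where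
  eq_ceil i := by simp
  zero_eq := by simp [doublingSchedule, doublingState]
  one_le i := by exact_mod_cast (doublingSchedule i).pos
  index_le i := by
    obtain ⟨j, k, hs, h0, hk, hi, hsum⟩ := doublingState_spec i
    have hw : (doublingSchedule i : ℕ) = 2 ^ j := by simp [doublingSchedule, hs]
    have hlog : Real.logb 2 ((2 : ℝ) ^ j) = j := by
      rw [Real.logb_pow, Real.logb_self_eq_one (by norm_num), mul_one]
    simp only [hw]
    push_cast
    rw [hlog]
    have : i ≤ j ^ 2 := by
      rcases Nat.eq_zero_or_pos j with rfl | hj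
      · simp [h0]
      · have := hk hj.ne'
        nlinarith
    exact_mod_cast this
  le_sum i := by
    obtain ⟨j, k, hs, h0, hk, hi, hsum⟩ := doublingState_spec i
    have hw : (doublingSchedule i : ℕ) = 2 ^ j := by simp [doublingSchedule, hs]
    have hlog : Real.logb 2 ((2 : ℝ) ^ j) = j := by
      rw [Real.logb_pow, Real.logb_self_eq_one (by norm_num), mul_one]
    have hsum' : ((j : ℝ) + k) * 2 ^ j
        ≤ ∑ t ∈ Finset.range i, ((doublingSchedule t : ℕ) : ℝ) + 2 * 2 ^ j := by
      exact_mod_cast hsum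
    simp only [hw]
    push_cast
    rw [hlog]
    have h1 : (0 : ℝ) ≤ k * 2 ^ j := by positivity
    have h2 : (0 : ℝ) < 2 ^ j := by positivity
    linarith

theorem le_logb_two_one_add {u : ℝ} (h0 : 0 ≤ u) (h1 : u ≤ 1) : u ≤ Real.logb 2 (1 + u) := by
  rw [Real.le_logb_iff_rpow_le (by norm_num) (by linarith)]
  have := rpow_one_add_le_one_add_mul_self (s := 1) (by norm_num) h0 h1
  norm_num at this ⊢
  exact this

theorem logb_two_le_two_mul_log {x : ℝ} (hx : 1 ≤ x) : Real.logb 2 x ≤ 2 * Real.log x := by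
  have h := Real.log_two_gt_d9
  rw [Real.logb, div_le_iff₀ (by linarith)]
  nlinarith [Real.log_nonneg hx]

theorem logb_two_one_add_le {u : ℝ} (h0 : 0 ≤ u) : Real.logb 2 (1 + u) ≤ 2 * u := by
  have := Real.log_le_sub_one_of_pos (x := 1 + u) (by linarith)
  linarith [logb_two_le_two_mul_log (x := 1 + u) (by linarith)]

theorem monotoneSize_one : monotoneSize 1 = 2 := by
  simp [monotoneSize]
  norm_num

theorem one_le_logb_monotoneSize_succ (i : ℕ) : 1 ≤ Real.logb 2 (monotoneSize (i + 1)) := by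
  rw [Real.le_logb_iff_rpow_le (by norm_num) (monotoneSize_pos _), Real.rpow_one]
  induction i with
  | zero => rw [monotoneSize_one]
  | succ i ih =>
    rw [monotoneSize]
    have : 0 ≤ 1 / max 1 (Real.logb 2 (monotoneSize (i + 1))) := by positivity
    nlinarith

theorem monotoneSize_succ_succ (i : ℕ) : monotoneSize (i + 2)
    = (1 + 1 / Real.logb 2 (monotoneSize (i + 1))) * monotoneSize (i + 1) := by
  rw [monotoneSize, max_eq_right (one_le_logb_monotoneSize_succ i)]

theorem logb_monotoneSize_succ_succ (i : ℕ) : Real.logb 2 (monotoneSize (i + 2))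
    = Real.logb 2 (monotoneSize (i + 1))
      + Real.logb 2 (1 + 1 / Real.logb 2 (monotoneSize (i + 1))) := by
  have h := one_le_logb_monotoneSize_succ i
  have h' : 0 ≤ 1 / Real.logb 2 (monotoneSize (i + 1)) := by positivity
  rw [monotoneSize_succ_succ, Real.logb_mul (by linarith) (monotoneSize_pos _).ne', add_comm]

/-- With `L = lg W`, a step adds at least `2 L lg (1 + 1 / L) ≥ 2` to `L ^ 2`. -/
theorem index_succ_le_logb_monotoneSize_sq (i : ℕ) :
    ((i + 1 : ℕ) : ℝ) ≤ Real.logb 2 (monotoneSize (i + 1)) ^ 2 := by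
  induction i with
  | zero => simp [monotoneSize_one]
  | succ i ih =>
    have h := one_le_logb_monotoneSize_succ i
    rw [logb_monotoneSize_succ_succ]
    set L := Real.logb 2 (monotoneSize (i + 1))
    have h1 := le_logb_two_one_add (u := 1 / L) (by positivity)
      (by rw [div_le_one (by linarith)]; exact h)
    have h2 : L * (1 / L) = 1 := by field_simp
    push_cast at ih ⊢
    have h3 : 1 ≤ L * Real.logb 2 (1 + 1 / L) := by
      calc 1 = L * (1 / L) := h2.symm
        _ ≤ _ := by gcongr
    nlinarith [sq_nonneg (Real.logb 2 (1 + 1 / L))]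

theorem monotoneSize_mul_le_sum (i : ℕ) :
    monotoneSize (i + 1) * (Real.logb 2 (monotoneSize (i + 1)) - 4)
      ≤ ∑ t ∈ Finset.range (i + 1), monotoneSize t := by
  induction i with
  | zero =>
    simp [monotoneSize]
    norm_num
  | succ i ih =>
    rw [Finset.sum_range_succ]
    refine le_trans ?_ (add_le_add_left ih _)
    have h := one_le_logb_monotoneSize_succ i
    have hV := monotoneSize_pos (i + 1)
    rw [logb_monotoneSize_succ_succ, monotoneSize_succ_succ]
    set L := Real.logb 2 (monotoneSize (i + 1))
    set V := monotoneSize (i + 1)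
    have hu : 0 < 1 / L := by positivity
    have hu1 : 1 / L ≤ 1 := by rw [div_le_one (by linarith)]; exact h
    have h1 := logb_two_one_add_le hu.le
    have h2 : L * (1 / L) = 1 := by field_simp
    set u := 1 / L
    -- Since `L u = 1`, the left side is at most `L - 3 - 2 u + 2 u ^ 2`, and `u ≤ 1`. The offset
    -- `4` supplies the term `-4 u` that absorbs the logarithm.
    have h3 : (1 + u) * (L + Real.logb 2 (1 + u) - 4) ≤ L - 4 + 1 := by
      have : (1 + u) * Real.logb 2 (1 + u) ≤ (1 + u) * (2 * u) := by gcongr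
      nlinarith
    calc (1 + u) * V * (L + Real.logb 2 (1 + u) - 4)
        = V * ((1 + u) * (L + Real.logb 2 (1 + u) - 4)) := by ring
      _ ≤ V * (L - 4 + 1) := by gcongr
      _ = _ := by ring

theorem hasLogGrowth_monotoneSchedule : HasLogGrowth monotoneSchedule monotoneSize where
  eq_ceil i := rfl
  zero_eq := rfl
  one_le i := by
    cases i with
    | zero => exact le_rfl
    | succ i =>
      have h := one_le_logb_monotoneSize_succ i
      rw [Real.le_logb_iff_rpow_le (by norm_num) (monotoneSize_pos _), Real.rpow_one] at h
      linarith
  index_le i := by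
    cases i with
    | zero => simp [monotoneSize]
    | succ i => exact index_succ_le_logb_monotoneSize_sq i
  le_sum i := by
    cases i with
    | zero => simp [monotoneSize]
    | succ i =>
      refine (monotoneSize_mul_le_sum i).trans (Finset.sum_le_sum fun t _ => ?_)
      exact Nat.le_ceil _

/-- Up to the first window with more than `M` slots there are few windows, with many slots. -/
theorem HasLogGrowth.exists_first_gt {w : ℕ → ℕ+} {V : ℕ → ℝ} (h : HasLogGrowth w V) {M : ℕ}
    (hM : 16 ≤ M) : ∃ b : ℕ, 0 < b ∧ (∀ i < b, (w i : ℕ) ≤ M) ∧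
      (b : ℝ) ≤ Real.logb 2 M ^ 2 + 1 ∧
      M * (Real.logb 2 M - 4) ≤ ∑ t ∈ Finset.range b, ((w t : ℕ) : ℝ) := by
  have hMR : (16 : ℝ) ≤ M := by exact_mod_cast hM
  have hwV (i : ℕ) : (w i : ℕ) ≤ M ↔ V i ≤ M := by rw [h.eq_ceil, Nat.ceil_le]
  have hidx {i : ℕ} (hi : (w i : ℕ) ≤ M) : (i : ℝ) ≤ Real.logb 2 M ^ 2 := by
    refine (h.index_le i).trans ?_
    have h1 := h.one_le i
    gcongr
    · exact Real.logb_nonneg (by norm_num) h1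
    · norm_num
    · exact (hwV i).1 hi
  have hex : ∃ b : ℕ, M < w b := by
    obtain ⟨b, hb⟩ := exists_nat_gt (Real.logb 2 M ^ 2)
    exact ⟨b, not_le.1 fun hle => absurd (hidx hle) (not_le.2 hb)⟩
  classical
  have hspec := Nat.find_spec hex
  have hmin : ∀ i < Nat.find hex, (w i : ℕ) ≤ M := fun i hi => not_lt.1 (Nat.find_min hex hi)
  set b := Nat.find hex
  have hb0 : 0 < b := by
    rcases Nat.eq_zero_or_pos b with hb | hb
    · rw [hb, h.eq_ceil, h.zero_eq] at hspec
      simp at hspec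
      omega
    · exact hb
  refine ⟨b, hb0, hmin, ?_, ?_⟩
  -- Window `b` itself exceeds `M`, so the index bound is applied one window earlier.
  · have h1 := hidx (hmin (b - 1) (by omega))
    rw [Nat.cast_sub hb0] at h1
    push_cast at h1
    linarith
  · have hVM : (M : ℝ) ≤ V b := by
      by_contra hlt
      exact absurd ((hwV b).2 (not_le.1 hlt).le) (not_le.2 hspec)
    refine le_trans ?_ (h.le_sum b)
    have hl : (4 : ℝ) ≤ Real.logb 2 M := by
      rw [Real.le_logb_iff_rpow_le (by norm_num) (by linarith)]
      exact le_trans (by norm_num) hMR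
    have hl2 : Real.logb 2 M ≤ Real.logb 2 (V b) :=
      Real.logb_le_logb_of_le (by norm_num) (by linarith) hVM
    gcongr
    linarith

/-! ### Asymptotics and choice of the cutoff. -/

theorem eventually_logb_sq_le_sqrt :
    ∀ᶠ n : ℕ in atTop, Real.logb 2 n ^ 2 ≤ √(n : ℝ) := by
  have h := (isLittleO_log_rpow_atTop (r := 1 / 4) (by norm_num)).bound
    (c := 1 / 2) (by norm_num)
  filter_upwards [tendsto_natCast_atTop_atTop.eventually h, eventually_ge_atTop 1] with n hn h1
  have h1' : (1 : ℝ) ≤ n := by exact_mod_cast h1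
  rw [Real.norm_of_nonneg (Real.log_nonneg h1'), Real.norm_of_nonneg (by positivity)] at hn
  have h2 : Real.logb 2 n ≤ (n : ℝ) ^ (1 / 4 : ℝ) := by
    linarith [logb_two_le_two_mul_log h1']
  calc Real.logb 2 n ^ 2 ≤ ((n : ℝ) ^ (1 / 4 : ℝ)) ^ 2 := by
        have := Real.logb_nonneg (b := 2) (by norm_num) h1'
        gcongr
    _ = √(n : ℝ) := by
        rw [← Real.rpow_natCast, ← Real.rpow_mul (by positivity), Real.sqrt_eq_rpow]
        norm_num

theorem eventually_mul_log_le_sqrt (a : ℝ) (ha : 0 < a) :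
    ∀ᶠ n : ℕ in atTop, a * Real.log n ≤ √(n : ℝ) := by
  have h := (isLittleO_log_rpow_atTop (r := 1 / 2) (by norm_num)).bound
    (c := a⁻¹) (by positivity)
  filter_upwards [tendsto_natCast_atTop_atTop.eventually h, eventually_ge_atTop 1] with n hn h1
  have h1' : (1 : ℝ) ≤ n := by exact_mod_cast h1
  rw [Real.norm_of_nonneg (Real.log_nonneg h1'), Real.norm_of_nonneg (by positivity),
    ← Real.sqrt_eq_rpow, inv_mul_eq_div, le_div_iff₀ ha] at hn
  linarith

theorem HasLogGrowth.eventually_le_choiceLaw_real {w : ℕ → ℕ+} {V : ℕ → ℝ}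
    (h : HasLogGrowth w V) {c : ℝ} (hc : 0 < c) : ∀ᶠ n : ℕ in atTop,
      1 - 1 / (n : ℝ) ^ c ≤ (choiceLaw w n).real
        {x | ENNReal.ofReal (1 / 256 * (n * Real.logb 2 n / Real.logb 2 (Real.logb 2 n))) ≤
          collisions x} := by
  have hlarge : ∀ᶠ n : ℕ in atTop, 2048 ≤ Real.logb 2 n :=
    ((Real.tendsto_logb_atTop (by norm_num)).comp
      tendsto_natCast_atTop_atTop).eventually_ge_atTop 2048
  filter_upwards [hlarge, eventually_logb_sq_le_sqrt,
    eventually_mul_log_le_sqrt (32 * (c + 1)) (by positivity), eventually_ge_atTop 4]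
    with n hl hsq hlog hn4
  have hn4' : (4 : ℝ) ≤ n := by exact_mod_cast hn4
  have hn0 : (0 : ℝ) < n := by linarith
  set l := Real.logb 2 (n : ℝ)
  set k := Real.logb 2 l
  set r := √(n : ℝ)
  have hr : r * r = n := Real.mul_self_sqrt hn0.le
  have hr2 : 2 ≤ r := Real.le_sqrt_of_sq_le (by linarith)
  have hk1 : 1 ≤ k := by
    rw [Real.le_logb_iff_rpow_le (by norm_num) (by linarith), Real.rpow_one]; linarith
  have hkl : k ≤ 2 * l :=
    (logb_two_le_two_mul_log (by linarith)).trans (by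
      linarith [Real.log_le_sub_one_of_pos (x := l) (by linarith)])
  -- `1024 k ≤ 2048 l ≤ l ^ 2 ≤ r`; this is why `l ≥ 2048` is required.
  have hkr : 1024 * k ≤ r := by nlinarith
  -- The factor `32` gives `n / (8 M) ≥ 4 k ≥ 4 log l`, so the exponential in `hload` is at least `l
  -- ^ 4`, against `b ≤ 2 l ^ 2`.
  set M := ⌊(n : ℝ) / (32 * k)⌋₊
  have hMle : (M : ℝ) ≤ n / (32 * k) := Nat.floor_le (by positivity)
  have hnk : 16 * r ≤ n / (64 * k) := by
    rw [le_div_iff₀ (by positivity)]; nlinarith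
  have hMge : n / (64 * k) ≤ M := by
    have h1 := Nat.lt_floor_add_one ((n : ℝ) / (32 * k))
    have h2 : (n : ℝ) / (32 * k) = n / (64 * k) + n / (64 * k) := by field_simp; norm_num
    linarith
  have hM16 : 16 ≤ M := by
    have : (16 : ℝ) ≤ M := by linarith
    exact_mod_cast this
  have hM0 : (0 : ℝ) < M := by linarith
  have hMnR : (M : ℝ) ≤ n := hMle.trans (div_le_self hn0.le (by linarith))
  have hMn : M ≤ n := by exact_mod_cast hMnR
  obtain ⟨b, hb0, hwM, hbl, hsum⟩ := h.exists_first_gt hM16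
  have hb0' : (0 : ℝ) < b := by exact_mod_cast hb0
  have hlM : Real.logb 2 M ≤ l := Real.logb_le_logb_of_le (by norm_num) hM0 hMnR
  have hlM0 : 0 ≤ Real.logb 2 M := Real.logb_nonneg (by norm_num) (by linarith)
  have hb2 : (b : ℝ) ≤ 2 * l ^ 2 := by nlinarith
  have hload : 4 * Real.exp 1 * b ≤ Real.exp (n / (8 * M)) := by
    have h1 : 4 * Real.log l ≤ n / (8 * M) := by
      have hkl' : Real.log l ≤ k := by
        have hlog0 : 0 ≤ Real.log l := Real.log_nonneg (by linarith)
        have := Real.log_two_lt_d9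
        have h2 := Real.log_two_gt_d9
        exact (le_div_iff₀ (by linarith)).2 (by nlinarith)
      rw [le_div_iff₀ (by positivity)] at hMle ⊢
      nlinarith
    have h2 : Real.exp (4 * Real.log l) = l ^ 4 := by
      rw [mul_comm, Real.exp_mul, Real.exp_log (by linarith)]
      norm_cast
    have h3 := Real.exp_one_lt_three
    calc 4 * Real.exp 1 * b ≤ 4 * 3 * (2 * l ^ 2) := by gcongr
      _ = 24 * l ^ 2 := by ring
      _ ≤ l ^ 2 * l ^ 2 := by gcongr; nlinarith
      _ = l ^ 4 := by ring
      _ = Real.exp (4 * Real.log l) := h2.symm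
      _ ≤ _ := Real.exp_le_exp.2 h1
  have hmain := le_choiceLaw_real_collisions hb0 hMn hwM hload
  have hfail : b * Real.exp (-(n / (16 * b))) ≤ 1 / (n : ℝ) ^ c := by
    have hbr : (b : ℝ) ≤ 2 * r := by linarith
    have h1 : r / 32 ≤ n / (16 * b) := by
      rw [div_le_div_iff₀ (by norm_num) (by positivity)]
      nlinarith
    have hbn : (b : ℝ) ≤ n := by nlinarith
    -- The exponent `n / (16 b)` is at least `r / 32 ≥ (c + 1) log n`; the extra `1` pays for the
    -- prefactor `b ≤ n`.
    calc b * Real.exp (-(n / (16 * b))) ≤ n * Real.exp (-((c + 1) * Real.log n)) := by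
          refine mul_le_mul hbn (Real.exp_le_exp.2 ?_) (by positivity) hn0.le
          linarith
      _ = n * (n : ℝ) ^ (-(c + 1)) := by
          rw [Real.rpow_def_of_pos hn0]; ring_nf
      _ = (n : ℝ) ^ (-c) := by
          nth_rewrite 1 [← Real.rpow_one (n : ℝ)]
          rw [← Real.rpow_add hn0]; ring_nf
      _ = _ := by rw [Real.rpow_neg hn0.le, one_div]
  have hcount : 1 / 256 * (n * l / k) ≤ (∑ i ∈ Finset.range b, ((w i : ℕ) : ℝ)) / 2 := by
    -- `M ≥ 16 √n`, and the factor `16` exactly offsets the `4`.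
    have h1 : l / 2 ≤ Real.logb 2 M - 4 := by
      have h2 : Real.logb 2 (16 * r) ≤ Real.logb 2 M :=
        Real.logb_le_logb_of_le (by norm_num) (by positivity) (hnk.trans hMge)
      have h3 : Real.logb 2 (16 * r) = 4 + l / 2 := by
        rw [Real.logb_mul (by norm_num) (by positivity),
          show (16 : ℝ) = 2 ^ (4 : ℕ) by norm_num, Real.logb_pow,
          Real.logb_self_eq_one (by norm_num), Real.logb, Real.log_sqrt hn0.le]
        simp only [l, Real.logb]
        push_cast
        ring
      linarith
    have h4 : n / (64 * k) * (l / 2) ≤ M * (Real.logb 2 M - 4) := by gcongr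
    have h5 : n / (64 * k) * (l / 2) = 2 * (1 / 256 * (n * l / k)) := by field_simp; norm_num
    linarith
  calc 1 - 1 / (n : ℝ) ^ c ≤ 1 - b * Real.exp (-(n / (16 * b))) := by linarith
    _ ≤ _ := hmain
    _ ≤ _ := measureReal_mono fun x hx => (ENNReal.ofReal_le_ofReal hcount).trans hx

end LogBackoff

theorem mainTheorem3 (w : ℕ → ℕ+)
    (hw : w = LogBackoff.doublingSchedule ∨ w = LogBackoff.monotoneSchedule) :
    ∃ C : ℝ, 0 < C ∧ ∀ c : ℝ, 1 < c → ∀ᶠ n : ℕ in atTop,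
      1 - 1 / (n : ℝ) ^ c ≤
        (LogBackoff.choiceLaw w n).real
          {x | ENNReal.ofReal (C * (n * Real.logb 2 n / Real.logb 2 (Real.logb 2 n))) ≤
            LogBackoff.collisions x} := by
  refine ⟨1 / 256, by norm_num, fun c hc => ?_⟩
  have hc0 : 0 < c := one_pos.trans hc
  rcases hw with rfl | rfl
  · exact LogBackoff.hasLogGrowth_doublingSchedule.eventually_le_choiceLaw_real hc0
  · exact LogBackoff.hasLogGrowth_monotoneSchedule.eventually_le_choiceLaw_real hc0
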